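/- There is an absolute constant $N$ such that the following holds. Let $p$ be a prime, and let $A, \Gamma \subset \mathbb{F}_p^*$ be multiplicative subgroups with $|A| \ge N$, $|\Gamma| \ge N$ and $$|\Gamma| \le p^{1/2} (\log_2 p)^{-1/5}.$$ Let $B \subseteq \mathbb{F}_p$ be an arbitrary nonempty set and let $\xi \in \mathbb{F}_p$. Then neither $\Gamma$ nor $\Gamma \sqcup \{0\}$ has a nontrivial representation as $\xi A + B$; that is, if $|\xi A| \ge 2$ and $|B| \ge 2$, then $\xi A + B \ne \Gamma$ and $\xi A + B \ne \Gamma \sqcup \{0\}$. Here $\xi A = \{\xi a : a \in A\}$ and $\xi A + B = \{\xi a + b : a \in A,\ b \in B\}$. -/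

import Mathlib

open scoped Pointwise

/-- A multiplicative subgroup of `F_p^*`, viewed as a subset of the field `F_p`. -/
def subgroupSet {p : ℕ} (H : Subgroup (ZMod p)ˣ) : Set (ZMod p) :=
  (fun u : (ZMod p)ˣ => (u : ZMod p)) '' (H : Set (ZMod p)ˣ)

/-- `S = X + Y` is a nontrivial additive representation of `S`: both summands have at least two
elements. -/
def IsNontrivialRep {p : ℕ} (S X Y : Set (ZMod p)) : Prop :=
  S = X + Y ∧ 2 ≤ X.ncard ∧ 2 ≤ Y.ncard

open Polynomial Finset

/-! ### Roots of unity: products of linear factors and power sums. -/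

section Field

variable {F : Type*} [Field F]

/-! Write m = |A|, n = |Γ|. The size hypothesis enters only through n² ≤ p, which keeps the integers
that must be invertible below p. After division by ξ, A is the set of all m-th roots of unity, and A
+ B is a coset T of Γ, possibly with 0 adjoined; on T the n-th power is a constant θ.

Stepanov's method: the polynomial Σ a(X + a)^(n+m-1) - mθ has degree exactly n, and vanishes at each
b in B to order m, or m - 1 when -b lies in A. Comparing this degree bound with the number of pairs
needed to cover T forces equality (`card_mul_eq`). Hence nonzero sums a + b are all distinct
(`injOn_pairs`), and the polynomial is a constant times the product of its forced factors
(`auxPoly_eq`).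

Unique representation lets power sums of T be expanded over A × B. Those of B then vanish at
exponents below n not divisible by m, and this makes B invariant under multiplication by A
(`mul_mem`). So B ∩ (-A) is empty or all of -A (`inner_eq`).

Comparing two consecutive Taylor coefficients at b gives a Stieltjes-type equation for Σ 1/(b - c)
(`local_relation`). Weighted by b^(m+1) - (-1)^m b and summed, it symmetrizes into a numerical
identity between m, n and |B| (`outer_relation`). Only two configurations survive: m even with B the
roots of x^m = -1, and m odd with B = -A. One further Taylor coefficient kills both
(`not_neg_one_roots_of_even`, `not_neg_of_odd`). -/

lemma prod_X_sub_C_of_pow_eq {ι : Type*} {S : Finset ι} {f : ι → F} {m : ℕ} {y : F} (hm : 0 < m)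
    (hcard : S.card = m) (hf : Function.Injective f) (hS : ∀ s ∈ S, f s ^ m = y) :
    ∏ s ∈ S, (X - C (f s)) = X ^ m - C y := by
  have hmon : (X ^ m - C y).Monic := monic_X_pow_sub_C _ hm.ne'
  have hmon2 : (∏ s ∈ S, (X - C (f s))).Monic :=
    monic_prod_of_monic _ _ fun s _ => monic_X_sub_C (f s)
  have hdvd : ∏ s ∈ S, (X - C (f s)) ∣ X ^ m - C y := by
    refine Finset.prod_dvd_of_coprime ?_ ?_
    · intro s _ t _ hst
      exact isCoprime_X_sub_C_of_isUnit_sub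
        (by rw [isUnit_iff_ne_zero, sub_ne_zero]; exact hf.ne hst)
    · intro s hs
      rw [dvd_iff_isRoot]
      simp [hS s hs]
  exact (eq_of_monic_of_dvd_of_natDegree_le hmon2 hmon hdvd (by
    rw [natDegree_finsetProd_X_sub_C_eq_card, natDegree_X_pow_sub_C, hcard])).symm

/-- `A` consists of all solutions of `x ^ m = 1`, and there are exactly `m` of them. -/
structure IsFullRootSet (A : Finset F) (m : ℕ) : Prop where
  card_eq : A.card = m
  mem_iff : ∀ x, x ∈ A ↔ x ^ m = 1

namespace IsFullRootSet

variable {A : Finset F} {m : ℕ}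

lemma one_mem (hA : IsFullRootSet A m) : (1 : F) ∈ A := by simp [hA.mem_iff]

lemma pos (hA : IsFullRootSet A m) : 0 < m := by
  rw [← hA.card_eq]
  exact Finset.card_pos.mpr ⟨1, hA.one_mem⟩

lemma ne_zero (hA : IsFullRootSet A m) {a : F} (ha : a ∈ A) : a ≠ 0 := by
  rintro rfl
  have := (hA.mem_iff 0).1 ha
  simp [hA.pos.ne'] at this

lemma mul_mem (hA : IsFullRootSet A m) {a b : F} (ha : a ∈ A) (hb : b ∈ A) : a * b ∈ A := by
  rw [hA.mem_iff] at *
  rw [mul_pow, ha, hb, one_mul]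

/-- Otherwise the m elements of A would all be roots of x^(j mod m) = 1, whose degree is positive
and less than m. -/
lemma exists_pow_ne_one [DecidableEq F] (hA : IsFullRootSet A m) {j : ℕ} (hj : ¬ m ∣ j) :
    ∃ a ∈ A, a ^ j ≠ 1 := by
  by_contra! h
  have hlt : j % m < m := Nat.mod_lt _ hA.pos
  have hpos : 0 < j % m := Nat.pos_of_ne_zero fun h0 => hj (Nat.dvd_of_mod_eq_zero h0)
  have hsub : A ⊆ (nthRoots (j % m) (1 : F)).toFinset := by
    intro a ha
    rw [Multiset.mem_toFinset, mem_nthRoots hpos]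
    have h1 := h a ha
    have h2 := (hA.mem_iff a).1 ha
    rwa [← Nat.div_add_mod j m, pow_add, pow_mul, h2, one_pow, one_mul] at h1
  have := (Finset.card_le_card hsub).trans ((Multiset.toFinset_card_le _).trans
    (card_nthRoots (j % m) (1 : F)))
  rw [hA.card_eq] at this
  omega

/-- Scaling by a permutes B and multiplies the power sum by a^j; choose a with a^j ≠ 1. -/
lemma sum_pow_eq_zero_of_invariant [DecidableEq F] (hA : IsFullRootSet A m) {B : Finset F}
    (hB : ∀ a ∈ A, ∀ b ∈ B, a * b ∈ B) {j : ℕ} (hj : ¬ m ∣ j) : ∑ b ∈ B, b ^ j = 0 := by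
  obtain ⟨a, ha, haj⟩ := hA.exists_pow_ne_one hj
  have hinj : Function.Injective (fun b : F => a * b) := mul_right_injective₀ (hA.ne_zero ha)
  have himg : B.image (fun b => a * b) = B :=
    Finset.eq_of_subset_of_card_le (Finset.image_subset_iff.2 fun b hb => hB a ha b hb)
      (Finset.card_image_of_injective _ hinj).ge
  have h1 : ∑ b ∈ B, b ^ j = a ^ j * ∑ b ∈ B, b ^ j := by
    conv_lhs => rw [← himg]
    rw [Finset.sum_image (fun x _ y _ h => hinj h), Finset.mul_sum]
    simp [mul_pow]
  have h2 : (1 - a ^ j) * ∑ b ∈ B, b ^ j = 0 := by linear_combination h1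
  rcases mul_eq_zero.1 h2 with h | h
  · exact absurd (sub_eq_zero.1 h).symm haj
  · exact h

lemma sum_pow [DecidableEq F] (hA : IsFullRootSet A m) (j : ℕ) :
    ∑ a ∈ A, a ^ j = if m ∣ j then (m : F) else 0 := by
  split_ifs with h
  · obtain ⟨l, rfl⟩ := h
    rw [Finset.sum_congr rfl (g := fun _ => (1 : F)) fun a ha => by
      rw [pow_mul, (hA.mem_iff a).1 ha, one_pow]]
    simp [hA.card_eq]
  · exact hA.sum_pow_eq_zero_of_invariant (fun a ha b hb => hA.mul_mem ha hb) h

/-- In the binomial expansion the exponents of a lie between 1 and i + 1 ≤ m, so only a^m can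
contribute. -/
lemma sum_mul_add_pow [DecidableEq F] (hA : IsFullRootSet A m) (x : F) {i : ℕ} (hi : i < m) :
    ∑ a ∈ A, a * (x + a) ^ i = if i = m - 1 then (m : F) else 0 := by
  have h1 : ∀ a : F, a * (x + a) ^ i
      = ∑ l ∈ range (i + 1), x ^ l * (i.choose l : F) * a ^ (i - l + 1) := by
    intro a
    rw [add_pow, Finset.mul_sum]
    exact Finset.sum_congr rfl fun l _ => by ring
  simp_rw [h1]
  rw [Finset.sum_comm]
  simp_rw [← Finset.mul_sum, hA.sum_pow]
  have hm := hA.pos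
  split_ifs with h
  · rw [Finset.sum_eq_single 0]
    · have : i - 0 + 1 = m := by omega
      rw [this]
      simp
    · intro l hl hl0
      have hl' := Finset.mem_range.1 hl
      rw [if_neg, mul_zero]
      exact Nat.not_dvd_of_pos_of_lt (by omega) (by omega)
    · simp
  · refine Finset.sum_eq_zero fun l hl => ?_
    have hl' := Finset.mem_range.1 hl
    rw [if_neg, mul_zero]
    exact Nat.not_dvd_of_pos_of_lt (by omega) (by omega)

/-- The monic polynomial with simple roots `-a`, `a ∈ A`. -/
lemma prod_X_add_C (hA : IsFullRootSet A m) :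
    ∏ a ∈ A, (X + C a) = (X ^ m - C ((-1) ^ m) : F[X]) := by
  rw [← prod_X_sub_C_of_pow_eq (f := fun a => -a) hA.pos hA.card_eq neg_injective fun a ha => by
    rw [neg_pow, (hA.mem_iff a).1 ha, mul_one]]
  simp

end IsFullRootSet

/-! ### The auxiliary polynomial: degree and high-order zeros. -/

lemma cast_ne_zero_of_lt (p : ℕ) [CharP F p] {c : ℕ} (h0 : 0 < c) (hc : c < p) : (c : F) ≠ 0 := by
  rw [Ne, CharP.cast_eq_zero_iff F p]
  exact Nat.not_dvd_of_pos_of_lt h0 hc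

lemma cast_choose_ne_zero_of_lt (p : ℕ) [hp : Fact p.Prime] [CharP F p] {N i : ℕ} (hN : N < p)
    (hi : i ≤ N) : (N.choose i : F) ≠ 0 := by
  rw [Ne, CharP.cast_eq_zero_iff F p]
  intro h
  have h1 : p ∣ N.factorial := by
    rw [← Nat.choose_mul_factorial_mul_factorial hi, mul_assoc]
    exact h.mul_right _
  exact absurd ((hp.out.dvd_factorial).1 h1) (by omega)

/-- The auxiliary polynomial of the polynomial method. -/
noncomputable def auxPoly (A : Finset F) (m n : ℕ) (θ : F) : F[X] :=
  ∑ a ∈ A, C a * (X + C a) ^ (n + m - 1) - C (m * θ)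

lemma coeff_taylor_auxPoly (A : Finset F) (m n : ℕ) (θ b : F) (j : ℕ) :
    (taylor b (auxPoly A m n θ)).coeff j
      = ((n + m - 1).choose j : F) * ∑ a ∈ A, a * (b + a) ^ (n + m - 1 - j)
        - if j = 0 then (m : F) * θ else 0 := by
  unfold auxPoly
  rw [map_sub, coeff_sub, map_sum, finsetSum_coeff, taylor_C, coeff_C, Finset.mul_sum]
  congr 1
  refine Finset.sum_congr rfl fun a _ => ?_
  have : taylor b (C a * (X + C a) ^ (n + m - 1)) = C a * (X + C (b + a)) ^ (n + m - 1) := by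
    simp [taylor_mul, add_assoc]
  rw [this, coeff_C_mul, coeff_X_add_C_pow]
  ring

lemma coeff_auxPoly (A : Finset F) (m n : ℕ) (θ : F) (j : ℕ) :
    (auxPoly A m n θ).coeff j
      = ((n + m - 1).choose j : F) * ∑ a ∈ A, a ^ (n + m - 1 - j + 1)
        - if j = 0 then (m : F) * θ else 0 := by
  have := coeff_taylor_auxPoly A m n θ 0 j
  rw [taylor_zero] at this
  rw [this]
  simp [pow_succ']

/-- Above degree n the coefficients carry power sums of A with exponent strictly between 0 and m,
which vanish; this is the drop from the apparent degree n + m - 1. -/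
lemma natDegree_auxPoly_le [DecidableEq F] {A : Finset F} {m n : ℕ} (hA : IsFullRootSet A m)
    (θ : F) : (auxPoly A m n θ).natDegree ≤ n := by
  rw [natDegree_le_iff_coeff_eq_zero]
  intro j hj
  have hm := hA.pos
  rw [coeff_auxPoly, if_neg (by omega), sub_zero, hA.sum_pow]
  rcases Nat.lt_or_ge (n + m - 1) j with h | h
  · simp [Nat.choose_eq_zero_of_lt h]
  · rw [if_neg, mul_zero]
    exact Nat.not_dvd_of_pos_of_lt (by omega) (by omega)

lemma coeff_auxPoly_self [DecidableEq F] {A : Finset F} {m n : ℕ} (hA : IsFullRootSet A m)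
    (hn : 0 < n) (θ : F) : (auxPoly A m n θ).coeff n = ((n + m - 1).choose n : F) * m := by
  have hm := hA.pos
  rw [coeff_auxPoly, if_neg (by omega), sub_zero, hA.sum_pow, if_pos]
  rw [show n + m - 1 - n + 1 = m by omega]

lemma X_sub_C_pow_dvd_iff_coeff_taylor (f : F[X]) (b : F) (d : ℕ) :
    (X - C b) ^ d ∣ f ↔ ∀ j < d, (taylor b f).coeff j = 0 := by
  rw [X_sub_C_pow_dvd_iff, ← taylor_apply, X_pow_dvd_iff]

/-- For j < m a factor (b + a)^n = θ splits off the j-th Taylor coefficient, leaving a sum evaluated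
by `sum_mul_add_pow`. It is nonzero only at j = 0, where the constant mθ cancels it. -/
lemma X_sub_C_pow_dvd_auxPoly [DecidableEq F] {A : Finset F} {m n : ℕ} (hA : IsFullRootSet A m)
    {θ b : F} (h : ∀ a ∈ A, (b + a) ^ n = θ) : (X - C b) ^ m ∣ auxPoly A m n θ := by
  rw [X_sub_C_pow_dvd_iff_coeff_taylor]
  intro j hj
  have hsum : ∑ a ∈ A, a * (b + a) ^ (n + m - 1 - j)
      = θ * ∑ a ∈ A, a * (b + a) ^ (m - 1 - j) := by
    rw [Finset.mul_sum]
    refine Finset.sum_congr rfl fun a ha => ?_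
    rw [show n + m - 1 - j = n + (m - 1 - j) by omega, pow_add, h a ha]
    ring
  rw [coeff_taylor_auxPoly, hsum, hA.sum_mul_add_pow b (by omega)]
  by_cases h0 : j = 0
  · subst h0
    simp [mul_comm]
  · rw [if_neg (by omega), if_neg h0]
    simp

lemma X_sub_C_pow_pred_dvd_auxPoly [DecidableEq F] {A : Finset F} {m n : ℕ}
    (hA : IsFullRootSet A m) {θ b : F} (h : ∀ a ∈ A, b + a = 0 ∨ (b + a) ^ n = θ) :
    (X - C b) ^ (m - 1) ∣ auxPoly A m n θ := by
  rw [X_sub_C_pow_dvd_iff_coeff_taylor]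
  intro j hj
  have hsum : ∑ a ∈ A, a * (b + a) ^ (n + m - 1 - j)
      = θ * ∑ a ∈ A, a * (b + a) ^ (m - 1 - j) := by
    rw [Finset.mul_sum]
    refine Finset.sum_congr rfl fun a ha => ?_
    rcases h a ha with h0 | h0
    -- Here j < m - 1 matters: the exponent m - 1 - j stays positive, so the zero term is harmless
    -- on both sides.
    · rw [h0, zero_pow (by omega), zero_pow (by omega)]
      ring
    · rw [show n + m - 1 - j = n + (m - 1 - j) by omega, pow_add, h0]
      ring
  rw [coeff_taylor_auxPoly, hsum, hA.sum_mul_add_pow b (by omega)]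
  by_cases h0 : j = 0
  · subst h0
    simp [mul_comm]
  · rw [if_neg (by omega), if_neg h0]
    simp

/-! ### Rigidity: the degree bound meets the covering bound. -/

/-- `A` is the full set of `m`-th roots of unity, `T` is a set of `n` roots of `x ^ n = θ`, and
`A + B` is `T` or `T ∪ {0}`. -/
structure IsCosetSum (A B T : Finset F) (m n : ℕ) (θ : F) : Prop where
  roots : IsFullRootSet A m
  pow_eq : ∀ t ∈ T, t ^ n = θ
  card_eq : T.card = n
  sum_pow : ∀ j, 0 < j → j < n → ∑ t ∈ T, t ^ j = 0
  ne_zero : θ ≠ 0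
  add_mem : ∀ a ∈ A, ∀ b ∈ B, a + b = 0 ∨ a + b ∈ T
  exists_add : ∀ t ∈ T, ∃ a ∈ A, ∃ b ∈ B, a + b = t

namespace IsCosetSum

variable {A B T : Finset F} {m n : ℕ} {θ : F}

lemma add_pow (h : IsCosetSum A B T m n θ) {a b : F} (ha : a ∈ A) (hb : b ∈ B) :
    b + a = 0 ∨ (b + a) ^ n = θ := by
  rw [add_comm b a]
  exact (h.add_mem a ha b hb).imp id (h.pow_eq _)

lemma T_ne_zero (h : IsCosetSum A B T m n θ) {t : F} (ht : t ∈ T) : t ≠ 0 := by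
  rintro rfl
  have hn : n ≠ 0 := by
    rw [← h.card_eq]
    exact (Finset.card_pos.2 ⟨0, ht⟩).ne'
  have := h.pow_eq 0 ht
  rw [zero_pow hn] at this
  exact h.ne_zero this.symm

variable [DecidableEq F]

/-- The elements of `B` outside `-A`. -/
def outer (A B : Finset F) : Finset F := B.filter fun b => -b ∉ A

/-- The elements of `B` in `-A`. -/
def inner (A B : Finset F) : Finset F := B.filter fun b => -b ∈ A

lemma add_ne_zero {a b : F} (ha : a ∈ A) (hb : b ∈ outer A B) : b + a ≠ 0 := by
  intro h0
  have : -b = a := by linear_combination -h0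
  exact (Finset.mem_filter.1 hb).2 (this ▸ ha)

lemma add_pow_outer (h : IsCosetSum A B T m n θ) {a b : F} (ha : a ∈ A) (hb : b ∈ outer A B) :
    (b + a) ^ n = θ :=
  (h.add_pow ha (Finset.mem_filter.1 hb).1).resolve_left (add_ne_zero ha hb)

lemma card_outer_add_card_inner : (outer A B).card + (inner A B).card = B.card := by
  rw [add_comm]
  exact Finset.card_filter_add_card_filter_not _

/-- The product of the linear factors forced by the multiplicities of the roots. -/
noncomputable def factorPoly (A B : Finset F) (m : ℕ) : F[X] :=
  (∏ b ∈ outer A B, (X - C b) ^ m) * ∏ b ∈ inner A B, (X - C b) ^ (m - 1)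

lemma factorPoly_monic : (factorPoly A B m).Monic :=
  (monic_prod_of_monic _ _ fun b _ => (monic_X_sub_C b).pow m).mul
    (monic_prod_of_monic _ _ fun b _ => (monic_X_sub_C b).pow (m - 1))

lemma natDegree_factorPoly : (factorPoly A B m).natDegree
    = m * (outer A B).card + (m - 1) * (inner A B).card := by
  unfold factorPoly
  rw [Monic.natDegree_mul (monic_prod_of_monic _ _ fun b _ => (monic_X_sub_C b).pow m)
      (monic_prod_of_monic _ _ fun b _ => (monic_X_sub_C b).pow (m - 1)),
    natDegree_prod_of_monic _ _ fun b _ => (monic_X_sub_C b).pow m,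
    natDegree_prod_of_monic _ _ fun b _ => (monic_X_sub_C b).pow (m - 1)]
  simp [mul_comm]

lemma factorPoly_dvd (h : IsCosetSum A B T m n θ) : factorPoly A B m ∣ auxPoly A m n θ := by
  have hcop : ∀ {x y : F}, x ≠ y → IsCoprime (X - C x) (X - C y) := fun hxy =>
    isCoprime_X_sub_C_of_isUnit_sub (by rwa [isUnit_iff_ne_zero, sub_ne_zero])
  refine IsCoprime.mul_dvd ?_ ?_ ?_
  · refine IsCoprime.prod_left fun b hb => IsCoprime.prod_right fun c hc => ?_
    refine (hcop ?_).pow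
    rintro rfl
    exact (Finset.mem_filter.1 hb).2 (Finset.mem_filter.1 hc).2
  · exact Finset.prod_dvd_of_coprime (fun b _ c _ hbc => (hcop hbc).pow) fun b hb =>
      X_sub_C_pow_dvd_auxPoly h.roots fun a ha => h.add_pow_outer ha hb
  · exact Finset.prod_dvd_of_coprime (fun b _ c _ hbc => (hcop hbc).pow) fun b hb =>
      X_sub_C_pow_pred_dvd_auxPoly h.roots fun a ha => h.add_pow ha (Finset.mem_filter.1 hb).1

/-- The pairs with nonzero sum. -/
def pairs (A B : Finset F) : Finset (F × F) := (A ×ˢ B).filter fun x => x.1 + x.2 ≠ 0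

/-- Each b in the inner part accounts for exactly one pair of sum zero, namely (-b, b). -/
lemma card_pairs (h : IsCosetSum A B T m n θ) :
    (pairs A B).card + (inner A B).card = m * B.card := by
  have h1 : ((A ×ˢ B).filter fun x => x.1 + x.2 = 0).card = (inner A B).card := by
    refine Finset.card_bij' (fun x _ => x.2) (fun b _ => (-b, b)) ?_ ?_ ?_ ?_
    · rintro ⟨a, b⟩ hx
      simp only [Finset.mem_filter, Finset.mem_product] at hx
      have : -b = a := by linear_combination -hx.2
      exact Finset.mem_filter.2 ⟨hx.1.2, this ▸ hx.1.1⟩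
    · intro b hb
      have := Finset.mem_filter.1 hb
      simp [this.1, this.2]
    · rintro ⟨a, b⟩ hx
      simp only [Finset.mem_filter, Finset.mem_product] at hx
      have : -b = a := by linear_combination -hx.2
      simp [this]
    · intro b _
      rfl
  rw [← h1, ← h.roots.card_eq, ← Finset.card_product, add_comm]
  exact Finset.card_filter_add_card_filter_not _

lemma image_pairs (h : IsCosetSum A B T m n θ) :
    (pairs A B).image (fun x => x.1 + x.2) = T := by
  ext t
  simp only [pairs, Finset.mem_image, Finset.mem_filter, Finset.mem_product, Prod.exists]
  constructor
  · rintro ⟨a, b, ⟨⟨ha, hb⟩, h0⟩, rfl⟩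
    exact (h.add_mem a ha b hb).resolve_left h0
  · intro ht
    obtain ⟨a, ha, b, hb, rfl⟩ := h.exists_add t ht
    exact ⟨a, b, ⟨⟨ha, hb⟩, h.T_ne_zero ht⟩, rfl⟩

lemma le_card_pairs (h : IsCosetSum A B T m n θ) : n ≤ (pairs A B).card := by
  conv_lhs => rw [← h.card_eq, ← h.image_pairs]
  exact Finset.card_image_le

section CharP

variable (p : ℕ) [Fact p.Prime] [CharP F p]

lemma coeff_auxPoly_ne_zero (h : IsCosetSum A B T m n θ) (hn : 0 < n) (hp : n + m ≤ p) :
    (auxPoly A m n θ).coeff n ≠ 0 := by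
  have hm := h.roots.pos
  rw [coeff_auxPoly_self h.roots hn]
  exact mul_ne_zero (cast_choose_ne_zero_of_lt p (by omega) (by omega))
    (cast_ne_zero_of_lt p hm (by omega))

/-- The bound of the polynomial method. -/
lemma card_mul_le (h : IsCosetSum A B T m n θ) (hn : 0 < n) (hp : n + m ≤ p) :
    m * (outer A B).card + (m - 1) * (inner A B).card ≤ n := by
  have h0 : auxPoly A m n θ ≠ 0 := fun h0 => h.coeff_auxPoly_ne_zero p hn hp (by simp [h0])
  rw [← natDegree_factorPoly]
  exact (natDegree_le_of_dvd h.factorPoly_dvd h0).trans (natDegree_auxPoly_le h.roots θ)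

lemma card_mul_eq (h : IsCosetSum A B T m n θ) (hn : 0 < n) (hp : n + m ≤ p) :
    m * B.card = n + (inner A B).card := by
  have h1 := h.card_mul_le p hn hp
  have h2 := h.le_card_pairs
  have h3 := h.card_pairs
  have h4 := card_outer_add_card_inner (A := A) (B := B)
  have hm := h.roots.pos
  obtain ⟨m, rfl⟩ : ∃ l, m = l + 1 := ⟨m - 1, by omega⟩
  rw [← h4] at h3 ⊢
  simp only [Nat.add_sub_cancel] at h1
  nlinarith

lemma injOn_pairs (h : IsCosetSum A B T m n θ) (hn : 0 < n) (hp : n + m ≤ p) :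
    Set.InjOn (fun x : F × F => x.1 + x.2) (pairs A B) := by
  rw [← Finset.card_image_iff, h.image_pairs, h.card_eq]
  have h1 := h.card_mul_eq p hn hp
  have h2 := h.card_pairs
  omega

/-- By `card_mul_eq` the forced factors already have total degree n, so the cofactor is constant. -/
lemma auxPoly_eq (h : IsCosetSum A B T m n θ) (hn : 0 < n) (hp : n + m ≤ p) :
    ∃ K : F, auxPoly A m n θ = C K * factorPoly A B m := by
  obtain ⟨q, hq⟩ := h.factorPoly_dvd
  have h0 : auxPoly A m n θ ≠ 0 := fun h0 => h.coeff_auxPoly_ne_zero p hn hp (by simp [h0])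
  have hq0 : q ≠ 0 := by
    rintro rfl
    exact h0 (by simpa using hq)
  have hd := natDegree_auxPoly_le (n := n) h.roots θ
  rw [hq, natDegree_mul factorPoly_monic.ne_zero hq0, natDegree_factorPoly] at hd
  have h1 := h.card_mul_eq p hn hp
  have h4 := card_outer_add_card_inner (A := A) (B := B)
  have hm := h.roots.pos
  have hdeg : q.natDegree = 0 := by
    obtain ⟨m, rfl⟩ : ∃ l, m = l + 1 := ⟨m - 1, by omega⟩
    rw [← h4] at h1
    simp only [Nat.add_sub_cancel] at hd
    nlinarith
  refine ⟨q.coeff 0, ?_⟩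
  rw [hq, mul_comm, ← eq_C_of_natDegree_eq_zero hdeg]

end CharP

end IsCosetSum

/-! ### Power sums of B and invariance under A. -/

namespace IsCosetSum

variable [DecidableEq F] {A B T : Finset F} {m n : ℕ} {θ : F}
variable (p : ℕ) [Fact p.Prime] [CharP F p]

lemma sum_add_pow (h : IsCosetSum A B T m n θ) (hp : n + m ≤ p) {j : ℕ} (hj0 : 0 < j)
    (hj : j < n) : ∑ b ∈ B, ∑ a ∈ A, (b + a) ^ j = 0 := by
  rw [Finset.sum_comm, ← Finset.sum_product (f := fun x : F × F => (x.2 + x.1) ^ j)]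
  have h1 : ∑ x ∈ pairs A B, (x.2 + x.1) ^ j = ∑ x ∈ A ×ˢ B, (x.2 + x.1) ^ j := by
    refine Finset.sum_subset (Finset.filter_subset _ _) fun x hx hx' => ?_
    have : x.1 + x.2 = 0 := by
      by_contra h0
      exact hx' (Finset.mem_filter.2 ⟨hx, h0⟩)
    rw [add_comm, this, zero_pow hj0.ne']
  rw [← h1, ← h.sum_pow j hj0 hj, ← h.image_pairs,
    Finset.sum_image (h.injOn_pairs p (by omega) hp)]
  exact Finset.sum_congr rfl fun x _ => by rw [add_comm]

lemma sum_choose_mul (h : IsCosetSum A B T m n θ) (hp : n + m ≤ p) {j : ℕ} (hj0 : 0 < j)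
    (hj : j < n) : ∑ i ∈ range (j + 1),
      (∑ b ∈ B, b ^ i) * (j.choose i : F) * (if m ∣ j - i then 1 else 0) = 0 := by
  have hm := h.roots.pos
  have hm0 : (m : F) ≠ 0 := cast_ne_zero_of_lt p hm (by omega)
  have h1 := h.sum_add_pow p hp hj0 hj
  simp_rw [_root_.add_pow] at h1
  have h2 : ∑ b ∈ B, ∑ a ∈ A, ∑ i ∈ range (j + 1), b ^ i * a ^ (j - i) * (j.choose i : F)
      = (m : F) * ∑ i ∈ range (j + 1),
      (∑ b ∈ B, b ^ i) * (j.choose i : F) * (if m ∣ j - i then 1 else 0) := by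
    rw [Finset.sum_congr rfl fun b _ => Finset.sum_comm, Finset.sum_comm, Finset.mul_sum]
    refine Finset.sum_congr rfl fun i _ => ?_
    simp_rw [← Finset.sum_mul, ← Finset.mul_sum, h.roots.sum_pow]
    split_ifs <;> simp [← Finset.sum_mul]
    ring
  rw [h2] at h1
  exact (mul_eq_zero.1 h1).resolve_left hm0

/-- Strong induction: in `sum_choose_mul` only i ≡ j mod m survive, and those with i < j are again
not divisible by m. -/
lemma sum_pow_eq_zero (h : IsCosetSum A B T m n θ) (hp : n + m ≤ p) :
    ∀ j < n, ¬ m ∣ j → ∑ b ∈ B, b ^ j = 0 := by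
  intro j
  induction j using Nat.strong_induction_on with
  | _ j ih =>
    intro hj hdvd
    have hj0 : 0 < j := Nat.pos_of_ne_zero fun h0 => hdvd (h0 ▸ dvd_zero m)
    have h1 := h.sum_choose_mul p hp hj0 hj
    rw [Finset.sum_range_succ, Finset.sum_eq_zero, zero_add] at h1
    · simpa using h1
    · intro i hi
      have hi' := Finset.mem_range.1 hi
      by_cases hd : m ∣ j - i
      · have : ¬ m ∣ i := fun hd' => hdvd (by
          have := dvd_add hd hd'
          rwa [Nat.sub_add_cancel hi'.le] at this)
        rw [ih i hi' (by omega) this]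
        simp
      · simp [hd]

lemma sum_pow_card (h : IsCosetSum A B T m n θ) (hp : n + m ≤ p) (hmn : m < n) :
    ∑ b ∈ B, b ^ m = -(B.card : F) := by
  have hm := h.roots.pos
  have h1 := h.sum_choose_mul p hp hm hmn
  obtain ⟨l, rfl⟩ : ∃ l, m = l + 1 := ⟨m - 1, by omega⟩
  rw [Finset.sum_range_succ, Finset.sum_range_succ', Finset.sum_eq_zero] at h1
  · simp at h1
    linear_combination h1
  · intro i hi
    have hi' := Finset.mem_range.1 hi
    rw [if_neg, mul_zero]
    exact Nat.not_dvd_of_pos_of_lt (by omega) (by omega)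

/-- Multiplication by `A` preserves `B`. -/
lemma mul_mem (h : IsCosetSum A B T m n θ) (hp : n + m ≤ p) (hn : 2 * B.card ≤ n) {a b : F}
    (ha : a ∈ A) (hb : b ∈ B) : a * b ∈ B := by
  by_contra hab
  have ha0 := h.roots.ne_zero ha
  -- B and aB have the same power sums below n, so no polynomial of degree below n distinguishes
  -- them.
  have hinv : ∀ g : F[X], g.natDegree < n → ∑ c ∈ B, g.eval (a * c) = ∑ c ∈ B, g.eval c := by
    intro g hg
    simp_rw [eval_eq_sum_range]
    rw [Finset.sum_comm, Finset.sum_comm (s := B)]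
    refine Finset.sum_congr rfl fun i hi => ?_
    have hi' := Finset.mem_range.1 hi
    simp_rw [mul_pow, ← Finset.mul_sum]
    by_cases hd : m ∣ i
    · obtain ⟨l, rfl⟩ := hd
      rw [pow_mul a, (h.roots.mem_iff a).1 ha]
      simp
    · rw [h.sum_pow_eq_zero p hp i (by omega) hd]
      simp
  have hpos : 0 < B.card := Finset.card_pos.2 ⟨b, hb⟩
  -- A test polynomial of degree 2|B| - 1 < n, vanishing on B and on all of aB except possibly ab;
  -- equality of the two sums forces it to vanish at ab too.
  set g : F[X] := (∏ c ∈ B, (X - C c)) * ∏ c ∈ B.erase b, (X - C (a * c)) with hg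
  have hdeg : g.natDegree < n := by
    refine lt_of_le_of_lt natDegree_mul_le ?_
    rw [natDegree_finsetProd_X_sub_C_eq_card B (fun c => c),
      natDegree_finsetProd_X_sub_C_eq_card (B.erase b) (fun c => a * c),
      Finset.card_erase_of_mem hb]
    omega
  have h1 := hinv g hdeg
  rw [Finset.sum_eq_single_of_mem b hb, Finset.sum_eq_zero] at h1
  · rw [hg, eval_mul, eval_prod, eval_prod] at h1
    rcases mul_eq_zero.1 h1 with h2 | h2
    · obtain ⟨c, hc, h3⟩ := Finset.prod_eq_zero_iff.1 h2
      simp only [eval_sub, eval_X, eval_C, sub_eq_zero] at h3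
      exact hab (h3 ▸ hc)
    · obtain ⟨c, hc, h3⟩ := Finset.prod_eq_zero_iff.1 h2
      simp only [eval_sub, eval_X, eval_C, sub_eq_zero] at h3
      exact (Finset.mem_erase.1 hc).1 (mul_left_cancel₀ ha0 h3).symm
  · intro c hc
    rw [hg, eval_mul, eval_prod, Finset.prod_eq_zero hc (by simp), zero_mul]
  · intro c hc hcb
    rw [hg, eval_mul, eval_prod, eval_prod, Finset.prod_eq_zero (s := B.erase b)
      (Finset.mem_erase.2 ⟨hcb, hc⟩) (by simp), mul_zero]

end IsCosetSum

/-! ### Low-order coefficients of powers and products; sums of inverses. -/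

lemma coeff_zero_pow_eq (L : F[X]) (e : ℕ) : (L ^ e).coeff 0 = L.coeff 0 ^ e := by
  simp [coeff_zero_eq_eval_zero]

lemma coeff_one_pow_eq (L : F[X]) (e : ℕ) :
    L.coeff 0 * (L ^ e).coeff 1 = e * L.coeff 1 * L.coeff 0 ^ e := by
  induction e with
  | zero => simp [coeff_one]
  | succ e ih =>
    rw [pow_succ, coeff_mul]
    simp [Finset.Nat.antidiagonal_succ, coeff_zero_pow_eq]
    linear_combination L.coeff 0 * ih

lemma coeff_two_pow_eq (L : F[X]) (e : ℕ) :
    2 * L.coeff 0 ^ 2 * (L ^ e).coeff 2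
      = (2 * e * L.coeff 2 * L.coeff 0 + e * (e - 1) * L.coeff 1 ^ 2) * L.coeff 0 ^ e := by
  induction e with
  | zero => simp [coeff_one]
  | succ e ih =>
    have h1 := coeff_one_pow_eq L e
    rw [pow_succ L, coeff_mul]
    simp [Finset.Nat.antidiagonal_succ, coeff_zero_pow_eq]
    linear_combination L.coeff 0 * ih + 2 * L.coeff 1 * L.coeff 0 * h1

section ProdCoeff

variable {ι : Type*} [DecidableEq ι]

/-- The low coefficients of `∏ (X + d i)` in terms of power sums of the inverses of `d i`. -/
lemma coeff_prod_X_add_C (s : Finset ι) (d : ι → F) (hd : ∀ i ∈ s, d i ≠ 0) :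
    (∏ i ∈ s, (X + C (d i))).coeff 0 ≠ 0 ∧
    (∏ i ∈ s, (X + C (d i))).coeff 1
      = (∏ i ∈ s, (X + C (d i))).coeff 0 * ∑ i ∈ s, (d i)⁻¹ ∧
    2 * (∏ i ∈ s, (X + C (d i))).coeff 2
      = (∏ i ∈ s, (X + C (d i))).coeff 0 * ((∑ i ∈ s, (d i)⁻¹) ^ 2 - ∑ i ∈ s, (d i)⁻¹ ^ 2) ∧
    6 * (∏ i ∈ s, (X + C (d i))).coeff 3
      = (∏ i ∈ s, (X + C (d i))).coeff 0 * ((∑ i ∈ s, (d i)⁻¹) ^ 3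
        - 3 * (∑ i ∈ s, (d i)⁻¹) * ∑ i ∈ s, (d i)⁻¹ ^ 2 + 2 * ∑ i ∈ s, (d i)⁻¹ ^ 3) := by
  induction s using Finset.induction_on with
  | empty => simp [coeff_one]
  | insert j s hj ih =>
    obtain ⟨h0, h1, h2, h3⟩ := ih fun i hi => hd i (Finset.mem_insert_of_mem hi)
    have hdj : d j ≠ 0 := hd j (Finset.mem_insert_self j s)
    have hr : d j * (d j)⁻¹ = 1 := mul_inv_cancel₀ hdj
    simp only [Finset.prod_insert hj, Finset.sum_insert hj]
    set Q := ∏ i ∈ s, (X + C (d i))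
    set s1 := ∑ i ∈ s, (d i)⁻¹
    set s2 := ∑ i ∈ s, (d i)⁻¹ ^ 2
    set s3 := ∑ i ∈ s, (d i)⁻¹ ^ 3
    have c0 : ((X + C (d j)) * Q).coeff 0 = d j * Q.coeff 0 := by simp [add_mul]
    have cs : ∀ k, ((X + C (d j)) * Q).coeff (k + 1) = Q.coeff k + d j * Q.coeff (k + 1) := by
      intro k
      simp [add_mul]
    rw [c0, cs 0, cs 1, cs 2]
    refine ⟨mul_ne_zero hdj h0, ?_, ?_, ?_⟩
    · linear_combination d j * h1 - Q.coeff 0 * hr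
    · linear_combination 2 * h1 + d j * h2 - 2 * Q.coeff 0 * s1 * hr
    · linear_combination 3 * h2 + d j * h3 - 3 * Q.coeff 0 * (s1 ^ 2 - s2) * hr

end ProdCoeff

lemma coeff_X_add_C_pow_sub_C (b c : F) (m : ℕ) :
    ((X + C b) ^ m - C c).coeff 0 = b ^ m - c ∧
    b * ((X + C b) ^ m - C c).coeff 1 = m * b ^ m ∧
    b ^ 2 * (2 * ((X + C b) ^ m - C c).coeff 2) = m * (m - 1) * b ^ m ∧
    b ^ 3 * (6 * ((X + C b) ^ m - C c).coeff 3) = m * (m - 1) * (m - 2) * b ^ m := by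
  have hc : ∀ k, ((X + C b) ^ m - C c).coeff (k + 1) = b ^ (m - (k + 1)) * m.choose (k + 1) := by
    intro k
    rw [coeff_sub, coeff_X_add_C_pow, coeff_C, if_neg (by omega), sub_zero]
  have hb : ∀ k, b ^ k * (b ^ (m - k) * (m.choose k : F)) = b ^ m * m.choose k := by
    intro k
    rcases Nat.lt_or_ge m k with h | h
    · simp [Nat.choose_eq_zero_of_lt h]
    · rw [← mul_assoc, ← pow_add, Nat.add_sub_cancel' h]
  have hsucc : ∀ k, (m.choose (k + 1) : F) * (k + 1) = m.choose k * (m - k) := by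
    intro k
    have h1 := Nat.choose_succ_right_eq m k
    rcases Nat.lt_or_ge m k with h | h
    · simp [Nat.choose_eq_zero_of_lt h, Nat.choose_eq_zero_of_lt (show m < k + 1 by omega)]
    · have h2 := congrArg (Nat.cast (R := F)) h1
      push_cast [Nat.cast_sub h] at h2
      exact h2
  have e1 : (m.choose 1 : F) = m := by simp
  have e2 : (m.choose 2 : F) * 2 = m * (m - 1) := by
    have := hsucc 1
    rw [e1] at this
    norm_num at this
    exact this
  have e3 : (m.choose 3 : F) * 6 = m * (m - 1) * (m - 2) := by
    have := hsucc 2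
    norm_num at this
    linear_combination 2 * this + (m - 2 : F) * e2
  have b1 := hb 1
  have b2 := hb 2
  have b3 := hb 3
  refine ⟨?_, ?_, ?_, ?_⟩
  · simp [coeff_zero_eq_eval_zero]
  · rw [hc 0]
    simp only [zero_add, pow_one] at *
    rw [b1, e1]
    ring
  · rw [hc 1]
    linear_combination 2 * b2 + b ^ m * e2
  · rw [hc 2]
    linear_combination 6 * b3 + b ^ m * e3

namespace IsFullRootSet

variable {A : Finset F} {m : ℕ}

lemma prod_X_add_C_add (hA : IsFullRootSet A m) (b : F) :
    ∏ a ∈ A, (X + C (b + a)) = (X + C b) ^ m - C ((-1) ^ m) := by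
  have := congrArg (fun q : F[X] => q.comp (X + C b)) hA.prod_X_add_C
  simp only [Polynomial.prod_comp, sub_comp, pow_comp, X_comp, C_comp, add_comp] at this
  rw [← this]
  exact Finset.prod_congr rfl fun a _ => by rw [C_add]; ring

/-- Power sums of the inverses `(b + a)⁻¹`. -/
lemma sum_inv [DecidableEq F] (hA : IsFullRootSet A m) {b : F} (hb : ∀ a ∈ A, b + a ≠ 0) :
    b ^ m - (-1) ^ m ≠ 0 ∧
    (b ^ m - (-1) ^ m) * (b * ∑ a ∈ A, (b + a)⁻¹) = m * b ^ m ∧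
    (b ^ m - (-1) ^ m) * (b ^ 2 * ((∑ a ∈ A, (b + a)⁻¹) ^ 2 - ∑ a ∈ A, (b + a)⁻¹ ^ 2))
      = m * (m - 1) * b ^ m ∧
    (b ^ m - (-1) ^ m) * (b ^ 3 * ((∑ a ∈ A, (b + a)⁻¹) ^ 3
        - 3 * (∑ a ∈ A, (b + a)⁻¹) * ∑ a ∈ A, (b + a)⁻¹ ^ 2 + 2 * ∑ a ∈ A, (b + a)⁻¹ ^ 3))
      = m * (m - 1) * (m - 2) * b ^ m := by
  obtain ⟨h0, h1, h2, h3⟩ := coeff_prod_X_add_C A (fun a => b + a) hb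
  rw [hA.prod_X_add_C_add] at h0 h1 h2 h3
  obtain ⟨g0, g1, g2, g3⟩ := coeff_X_add_C_pow_sub_C b ((-1) ^ m) m
  rw [g0] at h0 h1 h2 h3
  refine ⟨h0, ?_, ?_, ?_⟩
  · linear_combination g1 - b * h1
  · linear_combination g2 - b ^ 2 * h2
  · linear_combination g3 - b ^ 3 * h3

lemma sum_inv_mul (hA : IsFullRootSet A m) {b : F} (hb : ∀ a ∈ A, b + a ≠ 0) :
    ∑ a ∈ A, a * (b + a)⁻¹ = m - b * ∑ a ∈ A, (b + a)⁻¹ := by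
  rw [Finset.mul_sum, ← hA.card_eq, Finset.cast_card, ← Finset.sum_sub_distrib]
  refine Finset.sum_congr rfl fun a ha => ?_
  have := hb a ha
  field_simp
  ring

lemma sum_inv_pow_succ_mul {b : F} (hb : ∀ a ∈ A, b + a ≠ 0) (k : ℕ) :
    ∑ a ∈ A, a * (b + a)⁻¹ ^ (k + 1)
      = ∑ a ∈ A, (b + a)⁻¹ ^ k - b * ∑ a ∈ A, (b + a)⁻¹ ^ (k + 1) := by
  rw [Finset.mul_sum, ← Finset.sum_sub_distrib]
  refine Finset.sum_congr rfl fun a ha => ?_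
  have := mul_inv_cancel₀ (hb a ha)
  rw [pow_succ]
  linear_combination (b + a)⁻¹ ^ k * this

end IsFullRootSet

/-! ### Taylor coefficients at a point of B. -/

namespace IsCosetSum

variable [DecidableEq F] {A B T : Finset F} {m n : ℕ} {θ : F}

/-- Beyond order m - 1 the exponent drops below n, so (b + a)^n = θ turns the remaining power into a
negative one. -/
lemma coeff_taylor_outer (h : IsCosetSum A B T m n θ) {b : F} (hb : b ∈ outer A B) {i : ℕ}
    (hi : i < n) : (taylor b (auxPoly A m n θ)).coeff (m + i)
      = ((n + m - 1).choose (m + i) : F) * θ * ∑ a ∈ A, a * (b + a)⁻¹ ^ (i + 1) := by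
  have hm := h.roots.pos
  rw [coeff_taylor_auxPoly, if_neg (by omega), sub_zero, mul_assoc]
  congr 1
  rw [Finset.mul_sum]
  refine Finset.sum_congr rfl fun a ha => ?_
  have h0 := add_ne_zero ha hb
  rw [← h.add_pow_outer ha hb, show n + m - 1 - (m + i) = n - (i + 1) by omega, inv_pow,
    pow_sub₀ _ h0 (by omega)]
  ring

/-- The cofactor of `(X - b) ^ m` in the product of linear factors, centred at `b`. -/
noncomputable def cofactor (A B : Finset F) (m : ℕ) (b : F) : F[X] :=
  (∏ c ∈ (outer A B).erase b, (X + C (b - c))) ^ m *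
    (∏ c ∈ inner A B, (X + C (b - c))) ^ (m - 1)

lemma taylor_factorPoly {b : F} (hb : b ∈ outer A B) :
    taylor b (factorPoly A B m) = X ^ m * cofactor A B m b := by
  rw [taylor_apply, factorPoly, cofactor, ← Finset.mul_prod_erase _ _ hb, mul_comp, mul_comp,
    Polynomial.prod_comp, Polynomial.prod_comp, ← Finset.prod_pow, ← Finset.prod_pow]
  have : ∀ c : F, ∀ e : ℕ, ((X - C c) ^ e).comp (X + C b) = (X + C (b - c)) ^ e := by
    intro c e
    simp
    ring
  simp only [this]
  simp [mul_assoc]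

lemma cofactor_coeff {b : F} (hb : b ∈ outer A B) :
    (cofactor A B m b).coeff 0 ≠ 0 ∧ (cofactor A B m b).coeff 1 = (cofactor A B m b).coeff 0 *
      (m * ∑ c ∈ (outer A B).erase b, (b - c)⁻¹
        + ((m - 1 : ℕ) : F) * ∑ c ∈ inner A B, (b - c)⁻¹) := by
  obtain ⟨p0, p1, -⟩ := coeff_prod_X_add_C ((outer A B).erase b) (fun c => b - c)
    fun c hc => sub_ne_zero.2 (Finset.mem_erase.1 hc).1.symm
  obtain ⟨q0, q1, -⟩ := coeff_prod_X_add_C (inner A B) (fun c => b - c) fun c hc => by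
    rw [sub_ne_zero]
    rintro rfl
    exact (Finset.mem_filter.1 hb).2 (Finset.mem_filter.1 hc).2
  unfold cofactor
  set P := ∏ c ∈ (outer A B).erase b, (X + C (b - c))
  set Q := ∏ c ∈ inner A B, (X + C (b - c))
  have r1 := coeff_one_pow_eq P m
  have r2 := coeff_one_pow_eq Q (m - 1)
  rw [p1] at r1
  rw [q1] at r2
  have r1' : (P ^ m).coeff 1 = P.coeff 0 ^ m * (m * ∑ c ∈ (outer A B).erase b, (b - c)⁻¹) :=
    mul_left_cancel₀ p0 (by linear_combination r1)
  have r2' : (Q ^ (m - 1)).coeff 1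
      = Q.coeff 0 ^ (m - 1) * (((m - 1 : ℕ) : F) * ∑ c ∈ inner A B, (b - c)⁻¹) :=
    mul_left_cancel₀ q0 (by linear_combination r2)
  rw [mul_coeff_zero, mul_coeff_one, coeff_zero_pow_eq, coeff_zero_pow_eq, r1', r2']
  exact ⟨mul_ne_zero (pow_ne_zero _ p0) (pow_ne_zero _ q0), by ring⟩

variable (p : ℕ) [Fact p.Prime] [CharP F p]

/-- The relation obtained from the first two nonzero Taylor coefficients at `b`. -/
lemma local_relation (h : IsCosetSum A B T m n θ) (hn : 1 < n) (hp : n + m ≤ p) {b : F}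
    (hb : b ∈ outer A B) (hb0 : b ≠ 0) :
    ((n : F) - 1) * ∑ a ∈ A, (b + a)⁻¹ = (m + 1) * (m * ∑ c ∈ (outer A B).erase b, (b - c)⁻¹
        + ((m - 1 : ℕ) : F) * ∑ c ∈ inner A B, (b - c)⁻¹) := by
  have hm := h.roots.pos
  obtain ⟨K, hK⟩ := h.auxPoly_eq p (by omega) hp
  have hne : ∀ a ∈ A, b + a ≠ 0 := fun a ha => add_ne_zero ha hb
  have t0 := h.coeff_taylor_outer hb (i := 0) (by omega)
  have t1 := h.coeff_taylor_outer hb (i := 1) hn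
  rw [hK, taylor_mul, taylor_C, taylor_factorPoly hb, coeff_C_mul,
    add_comm m, coeff_X_pow_mul] at t0 t1
  obtain ⟨c0, c1⟩ := cofactor_coeff (m := m) hb
  rw [c1] at t1
  obtain ⟨v0, v1, v2, -⟩ := h.roots.sum_inv hne
  have psi1 := h.roots.sum_inv_mul hne
  have psi2 := IsFullRootSet.sum_inv_pow_succ_mul hne 1
  simp only [pow_one, zero_add, Nat.reduceAdd] at *
  set s1 := ∑ a ∈ A, (b + a)⁻¹
  set s2 := ∑ a ∈ A, (b + a)⁻¹ ^ 2
  set R := (m * ∑ c ∈ (outer A B).erase b, (b - c)⁻¹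
        + ((m - 1 : ℕ) : F) * ∑ c ∈ inner A B, (b - c)⁻¹ : F)
  set Ψ := ∑ a ∈ A, a * (b + a)⁻¹
  have hm0 : (m : F) ≠ 0 := cast_ne_zero_of_lt p hm (by omega)
  have hΨ : (b ^ m - (-1) ^ m) * Ψ = -(m * (-1) ^ m) := by
    rw [psi1]
    linear_combination -v1
  have hΨ0 : Ψ ≠ 0 := by
    intro h0
    rw [h0, mul_zero] at hΨ
    exact (neg_ne_zero.2 (mul_ne_zero hm0 (pow_ne_zero m (neg_ne_zero.2 one_ne_zero)))) hΨ.symm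
  -- This makes the ratio of the two sums over A equal to `s1`; dividing the two coefficient
  -- equations then eliminates K, θ and Ψ.
  have hΨ2 : s1 - b * s2 = s1 * Ψ := by
    refine mul_left_cancel₀ (mul_ne_zero v0 hb0) ?_
    rw [psi1]
    linear_combination (1 - m : F) * v1 + v2
  have hN : ((n + m - 1).choose (1 + m) : F) * (m + 1)
      = ((n + m - 1).choose m : F) * (n - 1) := by
    have h1 := congrArg (Nat.cast (R := F)) (Nat.choose_succ_right_eq (n + m - 1) m)
    rw [show n + m - 1 - m = n - 1 by omega] at h1
    push_cast [Nat.cast_sub hn.le] at h1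
    rw [add_comm 1 m]
    exact h1
  have hN0 : ((n + m - 1).choose m : F) ≠ 0 :=
    cast_choose_ne_zero_of_lt p (by omega) (by omega)
  rw [psi2, hΨ2] at t1
  refine mul_left_cancel₀ (mul_ne_zero (mul_ne_zero hN0 h.ne_zero) hΨ0) ?_
  linear_combination -(m + 1 : F) * t1 + (m + 1 : F) * R * t0 - θ * s1 * Ψ * hN

end IsCosetSum

/-! ### Symmetrizing the local relations. -/

section Symmetrization

variable [DecidableEq F]

lemma two_mul_sum_mul_inv_sub (s : Finset F) (g : F → F) :
    2 * ∑ b ∈ s, ∑ c ∈ s.erase b, g b * (b - c)⁻¹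
      = ∑ b ∈ s, ∑ c ∈ s.erase b, (g b - g c) * (b - c)⁻¹ := by
  have h1 : ∑ b ∈ s, ∑ c ∈ s.erase b, g b * (b - c)⁻¹
      = ∑ b ∈ s, ∑ c ∈ s.erase b, g c * (c - b)⁻¹ := by
    refine Finset.sum_comm' fun x y => ?_
    simp only [Finset.mem_erase]
    tauto
  have h2 : ∑ b ∈ s, ∑ c ∈ s.erase b, (g b - g c) * (b - c)⁻¹
      = ∑ b ∈ s, ∑ c ∈ s.erase b, g b * (b - c)⁻¹
        + ∑ b ∈ s, ∑ c ∈ s.erase b, g c * (c - b)⁻¹ := by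
    simp_rw [← Finset.sum_add_distrib]
    refine Finset.sum_congr rfl fun b _ => Finset.sum_congr rfl fun c _ => ?_
    rw [← neg_sub b c, inv_neg]
    ring
  rw [h2, ← h1]
  ring

/-- Each divided difference is a geometric sum in b and c; the diagonal c = b is added to factor the
double sum, then subtracted. -/
lemma sum_pow_sub_mul_inv_sub (s : Finset F) (m : ℕ) (u : F) :
    ∑ b ∈ s, ∑ c ∈ s.erase b, ((b ^ (m + 1) - u * b) - (c ^ (m + 1) - u * c)) * (b - c)⁻¹
      = ∑ i ∈ range (m + 1), (∑ b ∈ s, b ^ i) * (∑ b ∈ s, b ^ (m - i))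
        - (m + 1) * ∑ b ∈ s, b ^ m - u * (s.card * (s.card - 1)) := by
  have h1 : ∀ b ∈ s, ∑ c ∈ s.erase b,
      ((b ^ (m + 1) - u * b) - (c ^ (m + 1) - u * c)) * (b - c)⁻¹
      = ∑ c ∈ s, ∑ i ∈ range (m + 1), b ^ i * c ^ (m - i) - (m + 1) * b ^ m
        - u * (s.card - 1) := by
    intro b hb
    have h2 : ∀ c ∈ s.erase b, ((b ^ (m + 1) - u * b) - (c ^ (m + 1) - u * c)) * (b - c)⁻¹
        = ∑ i ∈ range (m + 1), b ^ i * c ^ (m - i) - u := by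
      intro c hc
      have h0 : b - c ≠ 0 := sub_ne_zero.2 (Finset.mem_erase.1 hc).1.symm
      have h3 := geom_sum₂_mul b c (m + 1)
      rw [Nat.add_sub_cancel] at h3
      rw [mul_inv_eq_iff_eq_mul₀ h0]
      linear_combination -h3
    rw [Finset.sum_congr rfl h2, Finset.sum_sub_distrib, Finset.sum_erase_eq_sub hb,
      Finset.sum_const, Finset.card_erase_of_mem hb, nsmul_eq_mul,
      Nat.cast_sub (Finset.card_pos.2 ⟨b, hb⟩)]
    have h4 : ∑ i ∈ range (m + 1), b ^ i * b ^ (m - i) = (m + 1) * b ^ m := by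
      rw [Finset.sum_congr rfl (g := fun _ => b ^ m) fun i hi => by
        rw [← pow_add, Nat.add_sub_cancel' (Nat.lt_succ_iff.1 (Finset.mem_range.1 hi))]]
      simp
    rw [h4]
    push_cast
    ring
  rw [Finset.sum_congr rfl h1, Finset.sum_sub_distrib, Finset.sum_sub_distrib, ← Finset.mul_sum,
    Finset.sum_const, nsmul_eq_mul]
  congr 1
  · congr 1
    rw [Finset.sum_congr rfl fun b _ => Finset.sum_comm, Finset.sum_comm]
    exact Finset.sum_congr rfl fun i _ => by rw [Finset.sum_mul_sum]
  · ring

end Symmetrization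

namespace IsCosetSum

variable [DecidableEq F] {A B T : Finset F} {m n : ℕ} {θ : F}

lemma outer_mul_mem (hA : IsFullRootSet A m) (hinv : ∀ a ∈ A, ∀ b ∈ B, a * b ∈ B) :
    ∀ a ∈ A, ∀ b ∈ outer A B, a * b ∈ outer A B := by
  intro a ha b hb
  obtain ⟨hb, hb'⟩ := Finset.mem_filter.1 hb
  refine Finset.mem_filter.2 ⟨hinv a ha b hb, fun h => hb' ?_⟩
  rw [hA.mem_iff] at *
  rwa [neg_mul_eq_mul_neg, mul_pow, ha, one_mul] at h

/-- The inner part is empty or equal to `-A`. -/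
lemma inner_eq (hA : IsFullRootSet A m) (hinv : ∀ a ∈ A, ∀ b ∈ B, a * b ∈ B) :
    inner A B = ∅ ∨ inner A B = A.image (fun a => -a) := by
  rcases (inner A B).eq_empty_or_nonempty with h | ⟨b, hb⟩
  · exact Or.inl h
  · right
    obtain ⟨hb, hb'⟩ := Finset.mem_filter.1 hb
    have hb0 : b ≠ 0 := neg_ne_zero.1 (hA.ne_zero hb')
    ext c
    simp only [inner, Finset.mem_filter, Finset.mem_image]
    constructor
    · rintro ⟨_, hc⟩
      exact ⟨-c, hc, neg_neg c⟩
    · rintro ⟨a, ha, rfl⟩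
      refine ⟨?_, by simpa using ha⟩
      have h1 : -a / b ∈ A := by
        rw [hA.mem_iff] at *
        rw [show -a / b = a / -b by rw [div_neg, neg_div], div_pow, ha, hb', div_one]
      have := hinv _ h1 b hb
      rwa [div_mul_cancel₀ _ hb0] at this

variable (p : ℕ) [Fact p.Prime] [CharP F p]

/-- The relation between the size of the outer part and its `m`-th power sum. The parameter `e` is
`0` or `m - 1` according to the size of the inner part. -/
lemma outer_relation (h : IsCosetSum A B T m n θ) (hm1 : 1 < m) (hn : 1 < n) (hp : n + m ≤ p)
    (hinv : ∀ a ∈ A, ∀ b ∈ B, a * b ∈ B) {e : F}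
    (he : ∀ b ∈ outer A B, ((m - 1 : ℕ) : F) * ∑ c ∈ inner A B, (b - c)⁻¹
      = e * ∑ a ∈ A, (b + a)⁻¹) :
    (m + 1) * ((2 * (outer A B).card - m - 1) * ∑ b ∈ outer A B, b ^ m
        - (-1) ^ m * ((outer A B).card * ((outer A B).card - 1)))
      = 2 * (n - 1 - (m + 1) * e) * ∑ b ∈ outer A B, b ^ m := by
  set S := outer A B
  have hm0 : (m : F) ≠ 0 := cast_ne_zero_of_lt p (by omega) (by omega)
  -- The weight b(b^m - (-1)^m) is the one that turns Σ 1/(b + a) into m b^m.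
  have hloc : ∀ b ∈ S, (m + 1) * ∑ c ∈ S.erase b, (b ^ (m + 1) - (-1) ^ m * b) * (b - c)⁻¹
      = (n - 1 - (m + 1) * e) * b ^ m := by
    intro b hb
    by_cases hb0 : b = 0
    · simp [hb0, show m ≠ 0 by omega]
    have h1 := h.local_relation p hn hp hb hb0
    rw [he b hb] at h1
    obtain ⟨-, v1, -⟩ := h.roots.sum_inv fun a ha => add_ne_zero ha hb
    rw [← Finset.mul_sum]
    refine mul_left_cancel₀ hm0 ?_
    linear_combination (-(b ^ (m + 1) - (-1) ^ m * b)) * h1 + (n - 1 - (m + 1) * e) * v1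
  have hsum := Finset.sum_congr rfl hloc
  rw [← Finset.mul_sum, ← Finset.mul_sum] at hsum
  have h2 := two_mul_sum_mul_inv_sub S (fun b => b ^ (m + 1) - (-1) ^ m * b)
  rw [sum_pow_sub_mul_inv_sub] at h2
  -- By A-invariance of the outer part only i = 0 and i = m contribute.
  have h3 : ∑ i ∈ range (m + 1), (∑ b ∈ S, b ^ i) * (∑ b ∈ S, b ^ (m - i))
      = 2 * S.card * ∑ b ∈ S, b ^ m := by
    obtain ⟨l, rfl⟩ : ∃ l, m = l + 1 := ⟨m - 1, by omega⟩
    rw [Finset.sum_range_succ, Finset.sum_range_succ', Finset.sum_eq_zero]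
    · simp
      ring
    · intro i hi
      have hi' := Finset.mem_range.1 hi
      rw [h.roots.sum_pow_eq_zero_of_invariant (outer_mul_mem h.roots hinv)
        (Nat.not_dvd_of_pos_of_lt (by omega) (by omega)), zero_mul]
  rw [h3] at h2
  linear_combination 2 * hsum - (m + 1 : F) * h2

end IsCosetSum

/-! ### The two exceptional configurations. -/

lemma cast_choose_add_two (N k : ℕ) :
    (N.choose (k + 2) : F) * ((k + 1) * (k + 2)) = N.choose k * ((N - k) * (N - k - 1)) := by
  have hsucc : ∀ k, (N.choose (k + 1) : F) * (k + 1) = N.choose k * (N - k) := by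
    intro k
    have h1 := Nat.choose_succ_right_eq N k
    rcases Nat.lt_or_ge N k with h | h
    · simp [Nat.choose_eq_zero_of_lt h, Nat.choose_eq_zero_of_lt (show N < k + 1 by omega)]
    · have h2 := congrArg (Nat.cast (R := F)) h1
      push_cast [Nat.cast_sub h] at h2
      exact h2
  have h1 := hsucc k
  have h2 := hsucc (k + 1)
  push_cast at h2
  linear_combination (k + 1 : F) * h2 + (N - k - 1 : F) * h1

namespace IsCosetSum

variable [DecidableEq F] {A B T : Finset F} {m n : ℕ} {θ : F}
variable (p : ℕ) [Fact p.Prime] [CharP F p]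

/-- `B` cannot be the set of solutions of `x ^ m = -1` when `m` is even. -/
lemma not_neg_one_roots_of_even (h : IsCosetSum A B T m n θ) (hm : 4 ≤ m) (hn : n = m ^ 2)
    (hp : n ^ 2 ≤ p) (heven : Even m) (hcard : B.card = m) (hB : ∀ b ∈ B, b ^ m = -1) : False := by
  have hnm : 4 * m ≤ n := by rw [hn]; nlinarith
  have hnp : 16 * n ≤ p := by nlinarith
  have hu : (-1 : F) ^ m = 1 := heven.neg_one_pow
  have h2 : (2 : F) ≠ 0 := by
    exact_mod_cast cast_ne_zero_of_lt (F := F) p (c := 2) (by omega) (by omega)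
  have hout : outer A B = B := by
    refine Finset.filter_true_of_mem fun b hb hb' => ?_
    have h1 := (h.roots.mem_iff _).1 hb'
    rw [neg_pow, hu, one_mul, hB b hb] at h1
    exact h2 (by linear_combination -h1)
  have hin : inner A B = ∅ := by
    have := card_outer_add_card_inner (A := A) (B := B)
    rw [hout] at this
    exact Finset.card_eq_zero.1 (by omega)
  obtain ⟨b, hb⟩ : B.Nonempty := Finset.card_pos.1 (by omega)
  have hbm := hB b hb
  have hb0 : b ≠ 0 := by
    rintro rfl
    rw [zero_pow (by omega)] at hbm
    exact one_ne_zero (neg_eq_zero.1 hbm.symm)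
  have hbo : b ∈ outer A B := hout.symm ▸ hb
  have hne : ∀ a ∈ A, b + a ≠ 0 := fun a ha => add_ne_zero ha hbo
  obtain ⟨K, hK⟩ := h.auxPoly_eq p (by omega) (by omega)
  have t0 := h.coeff_taylor_outer hbo (i := 0) (by omega)
  have t2 := h.coeff_taylor_outer hbo (i := 2) (by omega)
  have hcof : cofactor A B m b = (∏ c ∈ B.erase b, (X + C (b - c))) ^ m := by
    rw [cofactor, hout, hin]
    simp
  rw [hK, taylor_mul, taylor_C, taylor_factorPoly hbo, hcof, coeff_C_mul,
    add_comm m, coeff_X_pow_mul] at t0 t2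
  have hprod : X * ∏ c ∈ B.erase b, (X + C (b - c)) = (X + C b) ^ m - C (-1) := by
    have h1 := prod_X_sub_C_of_pow_eq (f := fun b : F => b) (by omega) hcard
      Function.injective_id hB
    have h3 := congrArg (fun q : F[X] => q.comp (X + C b)) h1
    simp only [Polynomial.prod_comp, sub_comp, pow_comp, X_comp, C_comp] at h3
    rw [← h3, ← Finset.mul_prod_erase _ _ hb, add_sub_cancel_right]
    congr 1
    exact Finset.prod_congr rfl fun c _ => by rw [C_sub]; ring
  set L := ∏ c ∈ B.erase b, (X + C (b - c))
  obtain ⟨-, d1, d2, d3⟩ := coeff_X_add_C_pow_sub_C b (-1) m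
  rw [← hprod, hbm] at d1 d2 d3
  simp only [coeff_X_mul] at d1 d2 d3
  have hL2 := coeff_two_pow_eq L m
  rw [coeff_zero_pow_eq] at t0
  obtain ⟨-, v1, v2, v3⟩ := h.roots.sum_inv hne
  have psi1 := h.roots.sum_inv_mul hne
  have psi3 := IsFullRootSet.sum_inv_pow_succ_mul hne 2
  rw [hbm, hu] at v1 v2 v3
  rw [psi3] at t2
  simp only [zero_add, pow_one] at t0
  rw [psi1] at t0
  simp only [Nat.reduceAdd] at t2
  have hN := cast_choose_add_two (F := F) (n + m - 1) m
  rw [Nat.cast_sub (by omega : 1 ≤ n + m), add_comm m 2] at hN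
  have hN0 : ((n + m - 1).choose m : F) ≠ 0 :=
    cast_choose_ne_zero_of_lt p (by omega) (by omega)
  have hnF : (n : F) = (m : F) ^ 2 := by rw [hn]; push_cast; rfl
  push_cast at hN
  rw [hnF] at hN
  set s1 := ∑ a ∈ A, (b + a)⁻¹
  set s2 := ∑ a ∈ A, (b + a)⁻¹ ^ 2
  set s3 := ∑ a ∈ A, (b + a)⁻¹ ^ 3
  set N0 := ((n + m - 1).choose m : F)
  set N2 := ((n + m - 1).choose (2 + m) : F)
  set M := (m : F)
  have x1 : 2 * (b * s1) = M := by linear_combination -v1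
  have x2 : 4 * (b ^ 2 * s2) = 2 * M - M ^ 2 := by
    linear_combination 2 * v2 + (2 * (b * s1) + M) * x1
  have x3 : 16 * (b ^ 3 * s3) = 8 * M - 6 * M ^ 2 := by
    linear_combination -4 * v3 - (4 * (b * s1) ^ 2 + 2 * (b * s1) * M + M ^ 2) * x1
      + 3 * (4 * (b ^ 2 * s2)) * x1 + 3 * M * x2
  have y1 : 2 * (M - b * s1) = M := by linear_combination -x1
  have y3 : 16 * (b ^ 2 * (s2 - b * s3)) = 2 * M ^ 2 := by linear_combination 4 * x2 - x3
  -- Orders m and m + 2 are compared, eliminating K.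
  have key : 2 * L.coeff 0 ^ 2 * ((M ^ 2 - 1) * (M ^ 2 - 2)) * (s2 - b * s3)
      = (M + 1) * (M + 2) * (2 * M * L.coeff 2 * L.coeff 0 + M * (M - 1) * L.coeff 1 ^ 2)
        * (M - b * s1) := by
    refine mul_left_cancel₀ (mul_ne_zero hN0 h.ne_zero) ?_
    linear_combination -(M + 1) * (M + 2) * 2 * L.coeff 0 ^ 2 * t2
      + (M + 1) * (M + 2) * K * hL2
      + (M + 1) * (M + 2) * (2 * M * L.coeff 2 * L.coeff 0 + M * (M - 1) * L.coeff 1 ^ 2) * t0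
      - 2 * L.coeff 0 ^ 2 * (s2 - b * s3) * θ * hN
  -- The factor M - 2 reflects a genuine example: {±1} + {±i} consists of four roots of x^4 = -4.
  have fin : 2 * (M ^ 4 * ((M - 1) * (M + 1)) * (M - 2) * (3 * M ^ 2 + 4 * M - 1)) = 0 := by
    have e0 : b * L.coeff 0 = -M := by linear_combination d1
    have e1 : 2 * (b ^ 2 * L.coeff 1) = -(M * (M - 1)) := by linear_combination d2
    have e2 : 6 * (b ^ 3 * L.coeff 2) = -(M * (M - 1) * (M - 2)) := by linear_combination d3
    have k1 : 6 * (b * L.coeff 0) ^ 2 * ((M ^ 2 - 1) * (M ^ 2 - 2)) * (16 * (b ^ 2 * (s2 - b * s3)))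
        = (M + 1) * (M + 2) * (8 * M * (6 * (b ^ 3 * L.coeff 2)) * (b * L.coeff 0)
          + 6 * M * (M - 1) * (2 * (b ^ 2 * L.coeff 1)) ^ 2) * (2 * (M - b * s1)) := by
      linear_combination 48 * b ^ 4 * key
    rw [e0, e1, e2, y1, y3] at k1
    linear_combination -k1
  have f0 : M ≠ 0 := cast_ne_zero_of_lt p (by omega) (by omega)
  have f1 : M + 1 ≠ 0 := by
    have := cast_ne_zero_of_lt (F := F) p (c := m + 1) (by omega) (by omega)
    rwa [Nat.cast_add, Nat.cast_one] at this
  have f2 : M - 1 ≠ 0 := by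
    have := cast_ne_zero_of_lt (F := F) p (c := m - 1) (by omega) (by omega)
    rwa [Nat.cast_sub (by omega), Nat.cast_one] at this
  have f3 : M - 2 ≠ 0 := by
    have := cast_ne_zero_of_lt (F := F) p (c := m - 2) (by omega) (by omega)
    rwa [Nat.cast_sub (by omega), Nat.cast_ofNat] at this
  have f4 : 3 * M ^ 2 + 4 * M - 1 ≠ 0 := by
    have := cast_ne_zero_of_lt (F := F) p (c := 3 * m ^ 2 + 4 * m - 1) (by omega) (by omega)
    rw [Nat.cast_sub (by omega)] at this
    push_cast at this
    exact this
  exact mul_ne_zero h2 (mul_ne_zero (mul_ne_zero (mul_ne_zero (pow_ne_zero 4 f0)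
    (mul_ne_zero f2 f1)) f3) f4) fin

/-- `B` cannot be `-A` when `m` is odd. -/
lemma not_neg_of_odd (h : IsCosetSum A B T m n θ) (hm : 4 ≤ m) (hn : n + m = m ^ 2)
    (hp : n ^ 2 ≤ p) (hodd : Odd m) (hB : B = A.image fun a => -a) : False := by
  have hnm : 3 * m ≤ n := by nlinarith
  have hnp : 12 * n ≤ p := by nlinarith
  have hu : (-1 : F) ^ m = -1 := hodd.neg_one_pow
  have hin : inner A B = B := by
    refine Finset.filter_true_of_mem fun b hb => ?_
    rw [hB] at hb
    obtain ⟨a, ha, rfl⟩ := Finset.mem_image.1 hb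
    simpa using ha
  have hout : outer A B = ∅ := by
    have := card_outer_add_card_inner (A := A) (B := B)
    rw [hin] at this
    exact Finset.card_eq_zero.1 (by omega)
  obtain ⟨K, hK⟩ := h.auxPoly_eq p (by omega) (by omega)
  have h1A := h.roots.one_mem
  have hprod := h.roots.prod_X_add_C_add (-1)
  rw [hu] at hprod
  have hfull := hprod
  rw [← Finset.mul_prod_erase _ _ h1A, neg_add_cancel, C_0, add_zero] at hprod
  have hfac : taylor (-1) (factorPoly A B m)
      = X ^ (m - 1) * (∏ a ∈ A.erase 1, (X + C (-1 + a))) ^ (m - 1) := by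
    rw [← mul_pow, hprod, ← hfull, factorPoly, hout, hin, hB,
      Finset.prod_image (fun x _ y _ hxy => neg_injective hxy), taylor_apply, mul_comp,
      ← Finset.prod_pow]
    simp only [Finset.prod_empty, one_comp, one_mul, Polynomial.prod_comp]
    refine Finset.prod_congr rfl fun a _ => ?_
    simp
    ring
  have hpow : ∀ a ∈ A.erase 1, -1 + a ≠ 0 ∧ (-1 + a) ^ n = θ := by
    intro a ha
    obtain ⟨ha1, ha⟩ := Finset.mem_erase.1 ha
    have h0 : -1 + a ≠ 0 := fun h0 => ha1 (by linear_combination h0)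
    refine ⟨h0, (h.add_pow ha ?_).resolve_left h0⟩
    rw [hB]
    exact Finset.mem_image_of_mem _ h1A
  -- The point -1 is a zero of order m - 1 only, so the orders compared are m - 1 and m + 1; the
  -- term a = 1 has b + a = 0 and is split off.
  have t0 := coeff_taylor_auxPoly A m n θ (-1) (0 + (m - 1))
  have t2 := coeff_taylor_auxPoly A m n θ (-1) (2 + (m - 1))
  rw [if_neg (by omega), sub_zero, hK, taylor_mul, taylor_C, hfac, coeff_C_mul,
    coeff_X_pow_mul] at t0 t2
  rw [show n + m - 1 - (0 + (m - 1)) = n by omega, ← Finset.add_sum_erase _ _ h1A,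
    neg_add_cancel, zero_pow (by omega), mul_zero, zero_add, coeff_zero_pow_eq, zero_add] at t0
  rw [show n + m - 1 - (2 + (m - 1)) = n - 2 by omega, ← Finset.add_sum_erase _ _ h1A,
    neg_add_cancel, zero_pow (by omega), mul_zero, zero_add] at t2
  obtain ⟨-, l1, l2, -⟩ := coeff_prod_X_add_C (A.erase 1) (fun a => -1 + a)
    fun a ha => (hpow a ha).1
  set L := ∏ a ∈ A.erase 1, (X + C (-1 + a))
  have hs0 : ∑ a ∈ A.erase 1, a * (-1 + a) ^ n = -θ := by
    have h1 : ∑ a ∈ A, a = 0 := by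
      have := h.roots.sum_pow 1
      rw [if_neg (by rw [Nat.dvd_one]; omega)] at this
      simpa using this
    rw [Finset.sum_congr rfl fun a ha => by rw [(hpow a ha).2], ← Finset.sum_mul,
      Finset.sum_erase_eq_sub h1A, h1]
    ring
  have hs2 : ∑ a ∈ A.erase 1, a * (-1 + a) ^ (n - 2)
      = θ * (∑ a ∈ A.erase 1, (-1 + a)⁻¹ + ∑ a ∈ A.erase 1, (-1 + a)⁻¹ ^ 2) := by
    rw [← Finset.sum_add_distrib, Finset.mul_sum]
    refine Finset.sum_congr rfl fun a ha => ?_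
    obtain ⟨h0, h1⟩ := hpow a ha
    rw [pow_sub₀ _ h0 (by omega), h1]
    field_simp
    ring
  rw [hs0] at t0
  rw [hs2] at t2
  obtain ⟨-, d1, d2, d3⟩ := coeff_X_add_C_pow_sub_C (-1 : F) (-1) m
  rw [← hprod, hu] at d1 d2 d3
  simp only [coeff_X_mul] at d1 d2 d3
  have hL2 := coeff_two_pow_eq L (m - 1)
  have hN := cast_choose_add_two (F := F) (n + m - 1) (m - 1)
  rw [add_comm (m - 1) 2] at hN
  have hN0 : ((n + m - 1).choose (m - 1) : F) ≠ 0 :=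
    cast_choose_ne_zero_of_lt p (by omega) (by omega)
  have hnF : (n : F) = (m : F) ^ 2 - m := by
    rw [eq_sub_iff_add_eq]
    exact_mod_cast congrArg (Nat.cast (R := F)) hn
  rw [Nat.cast_sub (by omega : 1 ≤ n + m), Nat.cast_sub (by omega : 1 ≤ m)] at hN
  rw [Nat.cast_sub (by omega : 1 ≤ m)] at hL2
  push_cast at hN hL2
  rw [hnF] at hN
  set s1 := ∑ a ∈ A.erase 1, (-1 + a)⁻¹
  set s2 := ∑ a ∈ A.erase 1, (-1 + a)⁻¹ ^ 2
  set N0 := ((n + m - 1).choose (m - 1) : F)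
  set N2 := ((n + m - 1).choose (2 + (m - 1)) : F)
  set M := (m : F)
  have f0 : M ≠ 0 := cast_ne_zero_of_lt p (by omega) (by omega)
  have e0 : L.coeff 0 = M := by linear_combination -d1
  have e1 : 2 * L.coeff 1 = -(M * (M - 1)) := by linear_combination d2
  have e2 : 6 * L.coeff 2 = M * (M - 1) * (M - 2) := by linear_combination -d3
  have x1 : 2 * s1 = -(M - 1) := by
    refine mul_left_cancel₀ f0 ?_
    linear_combination e1 - 2 * l1 - 2 * s1 * e0
  have x2 : 12 * (s1 + s2) = -((M - 1) * (M + 1)) := by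
    refine mul_left_cancel₀ f0 ?_
    linear_combination 12 * l2 - 12 * (s2 - s1 ^ 2) * e0 - 4 * e2
      + 3 * M * (2 * s1 - (M - 1)) * x1 + 6 * M * x1
  have key : 2 * L.coeff 0 ^ 2 * ((M ^ 2 - M) * (M ^ 2 - M - 1)) * (s1 + s2)
      = -(M * (M + 1) * (2 * (M - 1) * L.coeff 2 * L.coeff 0
        + (M - 1) * (M - 2) * L.coeff 1 ^ 2)) := by
    refine mul_left_cancel₀ (mul_ne_zero hN0 h.ne_zero) ?_
    linear_combination -M * (M + 1) * 2 * L.coeff 0 ^ 2 * t2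
      + M * (M + 1) * K * hL2
      + M * (M + 1) * (2 * (M - 1) * L.coeff 2 * L.coeff 0 + (M - 1) * (M - 2) * L.coeff 1 ^ 2) * t0
      - 2 * L.coeff 0 ^ 2 * (s1 + s2) * θ * hN
  -- The factor M - 3 is genuine: the six nonzero differences of cube roots of unity are roots of
  -- x^6 = -27.
  have fin : M ^ 4 * (M + 1) * (M - 1) ^ 2 * (M - 3) = 0 := by
    have k1 : 2 * L.coeff 0 ^ 2 * ((M ^ 2 - M) * (M ^ 2 - M - 1)) * (12 * (s1 + s2))
      = -(M * (M + 1) * (4 * (M - 1) * (6 * L.coeff 2) * L.coeff 0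
        + 3 * (M - 1) * (M - 2) * (2 * L.coeff 1) ^ 2)) := by
      linear_combination 12 * key
    rw [e0, e1, e2, x2] at k1
    linear_combination k1
  have f1 : M + 1 ≠ 0 := by
    have := cast_ne_zero_of_lt (F := F) p (c := m + 1) (by omega) (by omega)
    rwa [Nat.cast_add, Nat.cast_one] at this
  have f2 : M - 1 ≠ 0 := by
    have := cast_ne_zero_of_lt (F := F) p (c := m - 1) (by omega) (by omega)
    rwa [Nat.cast_sub (by omega), Nat.cast_one] at this
  have f3 : M - 3 ≠ 0 := by
    have := cast_ne_zero_of_lt (F := F) p (c := m - 3) (by omega) (by omega)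
    rwa [Nat.cast_sub (by omega), Nat.cast_ofNat] at this
  exact mul_ne_zero (mul_ne_zero (mul_ne_zero (pow_ne_zero 4 f0) f1) (pow_ne_zero 2 f2)) f3 fin

end IsCosetSum

/-! ### Case analysis on the inner part and the parity of m. -/

namespace IsCosetSum

variable [DecidableEq F] {A B T : Finset F} {m n : ℕ} {θ : F}
variable (p : ℕ) [Fact p.Prime] [CharP F p]

lemma card_le_succ (h : IsCosetSum A B T m n θ) (hB : B.Nonempty) : m ≤ n + 1 := by
  obtain ⟨b, hb⟩ := hB
  have hsub : A.image (fun a => a + b) ⊆ insert 0 T := by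
    refine Finset.image_subset_iff.2 fun a ha => ?_
    rcases h.add_mem a ha b hb with h0 | h0
    · simp [h0]
    · exact Finset.mem_insert_of_mem h0
  have h1 := (Finset.card_le_card hsub).trans (Finset.card_insert_le _ _)
  rwa [Finset.card_image_of_injective _ (add_left_injective b), h.roots.card_eq, h.card_eq] at h1

lemma false_of_inner_eq_empty (h : IsCosetSum A B T m n θ) (hm : 4 ≤ m) (hp : n ^ 2 ≤ p)
    (hmn : m < n) (hB : 2 ≤ B.card) (hinv : ∀ a ∈ A, ∀ b ∈ B, a * b ∈ B)
    (hin : inner A B = ∅) : False := by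
  have hnp : 5 * n ≤ p := by nlinarith
  have hout : outer A B = B := by
    refine Finset.eq_of_subset_of_card_le (Finset.filter_subset _ _) ?_
    have := card_outer_add_card_inner (A := A) (B := B)
    rw [hin, Finset.card_empty] at this
    omega
  have hcard := h.card_mul_eq p (by omega) (by omega)
  rw [hin, Finset.card_empty, add_zero] at hcard
  have hkn : 4 * B.card ≤ n := by nlinarith
  have hrel := h.outer_relation p (e := 0) (by omega) (by omega) (by omega) hinv
    (by simp [hin])
  rw [hout, h.sum_pow_card p (by omega) hmn] at hrel
  have hnF : (n : F) = m * B.card := by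
    rw [← hcard]
    push_cast
    rfl
  have hk0 : (B.card : F) ≠ 0 := cast_ne_zero_of_lt p (by omega) (by omega)
  rw [hnF] at hrel
  rcases Nat.even_or_odd m with he | ho
  · rw [he.neg_one_pow] at hrel
    have h1 : (B.card : F) * (((m + 3 : ℕ) : F) * ((B.card : F) - m)) = 0 := by
      push_cast
      linear_combination -hrel
    have h2 := (mul_eq_zero.1 ((mul_eq_zero.1 h1).resolve_left hk0)).resolve_left
      (cast_ne_zero_of_lt p (by omega) (by omega))
    have hkm : B.card = m := CharP.natCast_injOn_Iio F p (Set.mem_Iio.2 (by omega))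
      (Set.mem_Iio.2 (by omega)) (sub_eq_zero.1 h2)
    have hsum := h.sum_pow_card p (by omega) hmn
    have hnm : n = m ^ 2 := by rw [← hcard, hkm, sq]
    obtain ⟨b, hb, hb0⟩ : ∃ b ∈ B, b ≠ 0 := Finset.exists_mem_ne (by omega) 0
    -- With |B| = m, B is a single A-orbit, so x^m is constant on it; the m-th power sum -|B|
    -- identifies that constant as -1.
    have himg : A.image (fun a => a * b) = B := by
      refine Finset.eq_of_subset_of_card_le
        (Finset.image_subset_iff.2 fun a ha => hinv a ha b hb) ?_
      rw [Finset.card_image_of_injective _ (mul_left_injective₀ hb0), h.roots.card_eq, hkm]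
    have hpow : ∀ c ∈ B, c ^ m = b ^ m := by
      intro c hc
      rw [← himg] at hc
      obtain ⟨a, ha, rfl⟩ := Finset.mem_image.1 hc
      rw [mul_pow, (h.roots.mem_iff a).1 ha, one_mul]
    rw [Finset.sum_congr rfl hpow, Finset.sum_const, nsmul_eq_mul] at hsum
    have hbm : b ^ m = -1 := mul_left_cancel₀ hk0 (by linear_combination hsum)
    exact h.not_neg_one_roots_of_even p hm hnm hp he hkm fun c hc => (hpow c hc).trans hbm
  · rw [ho.neg_one_pow] at hrel
    have h1 : (B.card : F) * (((m - 1 : ℕ) : F) * ((B.card + m + 2 : ℕ) : F)) = 0 := by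
      push_cast [Nat.cast_sub (show 1 ≤ m by omega)]
      linear_combination hrel
    exact mul_ne_zero hk0 (mul_ne_zero (cast_ne_zero_of_lt p (by omega) (by omega))
      (cast_ne_zero_of_lt p (by omega) (by omega))) h1

lemma false_of_inner_eq_neg (h : IsCosetSum A B T m n θ) (hm : 4 ≤ m) (hp : n ^ 2 ≤ p)
    (hmn : m < n) (hinv : ∀ a ∈ A, ∀ b ∈ B, a * b ∈ B)
    (hin : inner A B = A.image (fun a => -a)) : False := by
  have hnp : 5 * n ≤ p := by nlinarith
  have hsub : ∀ a ∈ A, -a ∈ B := by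
    intro a ha
    have : -a ∈ inner A B := hin ▸ Finset.mem_image_of_mem _ ha
    exact (Finset.mem_filter.1 this).1
  rcases Nat.even_or_odd m with he | ho
  · have hneg : ∀ a ∈ A, -a ∈ A := fun a ha => by
      rw [h.roots.mem_iff] at *
      rw [he.neg_pow, ha]
    have hAB : A ⊆ B := fun a ha => by simpa using hsub _ (hneg a ha)
    have h1 := h.roots.one_mem
    -- For even m, A = -A lies in B, and 1 + a = a + 1 is a nonzero sum represented twice.
    obtain ⟨a, ha, ha'⟩ : ∃ a ∈ A, a ∉ ({1, -1} : Finset F) := by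
      refine Finset.exists_mem_notMem_of_card_lt_card ?_
      rw [h.roots.card_eq]
      exact Finset.card_le_two.trans_lt (by omega)
    simp only [Finset.mem_insert, Finset.mem_singleton, not_or] at ha'
    have h0 : 1 + a ≠ 0 := fun h0 => ha'.2 (by linear_combination h0)
    have hinj := h.injOn_pairs p (by omega) (by omega)
      (x₁ := (1, a)) (x₂ := (a, 1)) (by simp [pairs, h1, hAB ha, h0])
      (by simp [pairs, ha, hAB h1, add_comm a 1, h0]) (add_comm 1 a)
    exact ha'.1 (Prod.ext_iff.1 hinj).2
  · have hcin : (inner A B).card = m := by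
      rw [hin, Finset.card_image_of_injective _ neg_injective, h.roots.card_eq]
    have hk := card_outer_add_card_inner (A := A) (B := B)
    have hcard := h.card_mul_eq p (by omega) (by omega)
    rw [hcin] at hcard hk
    rw [← hk] at hcard
    have hkn : (outer A B).card ≤ n := by nlinarith
    -- Since the inner part is -A, its sum of 1/(b - c) is the sum of 1/(b + a) over A.
    have hrel := h.outer_relation p (e := (m - 1 : ℕ)) (by omega) (by omega) (by omega) hinv (by
      intro b _
      rw [hin, Finset.sum_image fun x _ y _ hxy => neg_injective hxy]
      simp)
    have hS : ∑ b ∈ outer A B, b ^ m = -((outer A B).card : F) := by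
      have h1 := h.sum_pow_card p (by omega) hmn
      have h2 : ∑ b ∈ inner A B, b ^ m + ∑ b ∈ outer A B, b ^ m = ∑ b ∈ B, b ^ m :=
        Finset.sum_filter_add_sum_filter_not _ _ _
      have h3 : ∑ b ∈ inner A B, b ^ m = -(m : F) := by
        rw [hin, Finset.sum_image fun x _ y _ hxy => neg_injective hxy]
        rw [Finset.sum_congr rfl (g := fun _ => (-1 : F)) fun a ha => by
          rw [ho.neg_pow, (h.roots.mem_iff a).1 ha]]
        simp [h.roots.card_eq]
      rw [h3, h1, ← hk] at h2
      push_cast at h2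
      linear_combination h2
    have hnF : (n : F) = m * ((outer A B).card + m) - m := by
      rw [eq_sub_iff_add_eq]
      exact_mod_cast congrArg (Nat.cast (R := F)) hcard.symm
    rw [hS, ho.neg_one_pow, hnF, Nat.cast_sub (show 1 ≤ m by omega)] at hrel
    have h1 : ((outer A B).card : F)
        * (((m - 1 : ℕ) : F) * (((outer A B).card + m : ℕ) : F)) = 0 := by
      push_cast [Nat.cast_sub (show 1 ≤ m by omega)]
      push_cast at hrel
      linear_combination hrel
    have h2 := (mul_eq_zero.1 h1).resolve_right
      (mul_ne_zero (cast_ne_zero_of_lt p (by omega) (by omega))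
        (cast_ne_zero_of_lt p (by omega) (by omega)))
    have h3 : (outer A B).card = 0 := by
      by_contra h0
      exact cast_ne_zero_of_lt p (Nat.pos_of_ne_zero h0) (by omega) h2
    refine h.not_neg_of_odd p hm ?_ hp ho ?_
    · rw [h3, zero_add] at hcard
      rw [sq, hcard]
    · rw [← hin]
      refine (Finset.eq_of_subset_of_card_le (Finset.filter_subset _ _) ?_).symm
      change B.card ≤ (inner A B).card
      omega

theorem false_of_sq_le (h : IsCosetSum A B T m n θ) (hm : 4 ≤ m) (hn : 4 ≤ n) (hp : n ^ 2 ≤ p)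
    (hB : 2 ≤ B.card) : False := by
  have hmn := h.card_le_succ (Finset.card_pos.1 (by omega))
  have hnp : n + m ≤ p := by nlinarith
  have hcard := h.card_mul_eq p (by omega) hnp
  have hr : (inner A B).card ≤ B.card := Finset.card_filter_le _ _
  have h2k : 2 * B.card ≤ n := by nlinarith
  have hlt : m < n := by nlinarith
  have hinv : ∀ a ∈ A, ∀ b ∈ B, a * b ∈ B := fun a ha b hb => h.mul_mem p hnp h2k ha hb
  rcases inner_eq h.roots hinv with hin | hin
  · exact h.false_of_inner_eq_empty p hm hp hlt hB hinv hin
  · exact h.false_of_inner_eq_neg p hm hp hlt hinv hin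

end IsCosetSum

end Field

/-! ### Transfer to subgroups of the multiplicative group. -/

section Subgroups

variable {p : ℕ} [Fact p.Prime]

open Classical in
lemma isFullRootSet_subgroup (H : Subgroup (ZMod p)ˣ) :
    IsFullRootSet (subgroupSet H).toFinset (Nat.card H) := by
  have hcard : (subgroupSet H).toFinset.card = Nat.card H := by
    rw [← Set.ncard_eq_toFinset_card', subgroupSet,
      Set.ncard_image_of_injective _ Units.val_injective]
    rfl
  have hpow : ∀ x ∈ (subgroupSet H).toFinset, x ^ Nat.card H = 1 := by
    intro x hx
    obtain ⟨u, hu, rfl⟩ := Set.mem_toFinset.1 hx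
    have : (⟨u, hu⟩ : H) ^ Nat.card H = 1 := pow_card_eq_one'
    have hu1 : u ^ Nat.card H = 1 := congrArg Subtype.val this
    simpa using congrArg Units.val hu1
  have hpos : 0 < Nat.card H := Nat.card_pos
  refine ⟨hcard, fun x => ⟨hpow x, fun hx => ?_⟩⟩
  have hsub : (subgroupSet H).toFinset ⊆ (nthRoots (Nat.card H) (1 : ZMod p)).toFinset := by
    intro y hy
    rw [Multiset.mem_toFinset, mem_nthRoots hpos]
    exact hpow y hy
  rw [Finset.eq_of_subset_of_card_le hsub ((Multiset.toFinset_card_le _).trans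
    ((card_nthRoots _ _).trans hcard.ge)), Multiset.mem_toFinset, mem_nthRoots hpos]
  exact hx

open Classical in
-- Letting S lie between Γ and Γ ∪ {0} treats both targets at once. Dividing by ξ gives T = ξ⁻¹Γ and
-- θ = ξ⁻ⁿ.
lemma not_isNontrivialRep (A Γ : Subgroup (ZMod p)ˣ) (hA : 4 ≤ Nat.card A) (hΓ : 4 ≤ Nat.card Γ)
    (hp : Nat.card Γ ^ 2 ≤ p) (ξ : ZMod p) (B S : Set (ZMod p)) (hS : subgroupSet Γ ⊆ S)
    (hS' : S ⊆ subgroupSet Γ ∪ {0}) : ¬ IsNontrivialRep S (ξ • subgroupSet A) B := by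
  rintro ⟨hsum, hX, hB⟩
  have hξ : ξ ≠ 0 := by
    rintro rfl
    have : ((0 : ZMod p) • subgroupSet A).ncard ≤ 1 := by
      refine (Set.ncard_le_ncard (t := {0}) ?_).trans (Set.ncard_singleton _).le
      exact Set.zero_smul_set_subset _
    omega
  have hrA := isFullRootSet_subgroup A
  have hrΓ := isFullRootSet_subgroup Γ
  have hinj : Function.Injective (fun x : ZMod p => ξ⁻¹ * x) :=
    mul_right_injective₀ (inv_ne_zero hξ)
  have hcos : IsCosetSum (subgroupSet A).toFinset (B.toFinset.image fun x => ξ⁻¹ * x)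
      ((subgroupSet Γ).toFinset.image fun x => ξ⁻¹ * x) (Nat.card A) (Nat.card Γ)
      (ξ⁻¹ ^ Nat.card Γ) := by
    refine ⟨hrA, ?_, ?_, ?_, pow_ne_zero _ (inv_ne_zero hξ), ?_, ?_⟩
    · intro t ht
      obtain ⟨x, hx, rfl⟩ := Finset.mem_image.1 ht
      rw [mul_pow, (hrΓ.mem_iff x).1 hx, mul_one]
    · rw [Finset.card_image_of_injective _ hinj, hrΓ.card_eq]
    · intro j hj0 hj
      rw [Finset.sum_image fun x _ y _ hxy => hinj hxy]
      simp_rw [mul_pow]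
      rw [← Finset.mul_sum, hrΓ.sum_pow, if_neg (Nat.not_dvd_of_pos_of_lt hj0 hj), mul_zero]
    · intro a ha b hb
      obtain ⟨c, hc, rfl⟩ := Finset.mem_image.1 hb
      rw [Set.mem_toFinset] at ha hc
      have hmem : ξ * a + c ∈ S := by
        rw [hsum]
        exact Set.add_mem_add (Set.smul_mem_smul_set ha) hc
      have heq : a + ξ⁻¹ * c = ξ⁻¹ * (ξ * a + c) := by field_simp
      rw [heq]
      rcases hS' hmem with h0 | h0
      · exact Or.inr (Finset.mem_image_of_mem _ (Set.mem_toFinset.2 h0))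
      · rw [Set.mem_singleton_iff] at h0
        exact Or.inl (by rw [h0, mul_zero])
    · intro t ht
      obtain ⟨x, hx, rfl⟩ := Finset.mem_image.1 ht
      have hmem := hS (Set.mem_toFinset.1 hx)
      rw [hsum] at hmem
      obtain ⟨y, hy, b, hb, rfl⟩ := Set.mem_add.1 hmem
      obtain ⟨a, ha, rfl⟩ := Set.mem_smul_set.1 hy
      refine ⟨a, Set.mem_toFinset.2 ha, ξ⁻¹ * b,
        Finset.mem_image_of_mem _ (Set.mem_toFinset.2 hb), ?_⟩
      rw [smul_eq_mul]
      field_simp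
  refine hcos.false_of_sq_le p hA hΓ hp ?_
  rw [Finset.card_image_of_injective _ hinj, ← Set.ncard_eq_toFinset_card']
  exact hB

end Subgroups

lemma sq_le_of_le_rpow_mul_logb {n p : ℕ} (hp : 2 ≤ p)
    (h : (n : ℝ) ≤ (p : ℝ) ^ (1 / 2 : ℝ) * (Real.logb 2 (p : ℝ)) ^ (-(1 / 5) : ℝ)) :
    n ^ 2 ≤ p := by
  have hlog : 1 ≤ Real.logb 2 (p : ℝ) := by
    rw [Real.le_logb_iff_rpow_le (by norm_num) (by positivity), Real.rpow_one]
    exact_mod_cast hp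
  have h1 : (Real.logb 2 (p : ℝ)) ^ (-(1 / 5) : ℝ) ≤ 1 :=
    Real.rpow_le_one_of_one_le_of_nonpos hlog (by norm_num)
  have h2 : (n : ℝ) ≤ √p := by
    rw [Real.sqrt_eq_rpow]
    exact h.trans (mul_le_of_le_one_right (by positivity) h1)
  have h3 : (n : ℝ) ^ 2 ≤ p := (Real.le_sqrt (by positivity) (by positivity)).1 h2
  exact_mod_cast h3

theorem mainTheorem3 :
    ∃ N : ℕ, ∀ (p : ℕ) [Fact p.Prime] (A Γ : Subgroup (ZMod p)ˣ),
      N ≤ Nat.card A → N ≤ Nat.card Γ →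
      (Nat.card Γ : ℝ) ≤ (p : ℝ) ^ (1 / 2 : ℝ) * (Real.logb 2 (p : ℝ)) ^ (-(1 / 5) : ℝ) →
      ∀ (ξ : ZMod p) (B : Set (ZMod p)), B.Nonempty →
        ¬ IsNontrivialRep (subgroupSet Γ) (ξ • subgroupSet A) B ∧
        ¬ IsNontrivialRep (subgroupSet Γ ∪ {0}) (ξ • subgroupSet A) B := by
  refine ⟨4, fun p hp A Γ hA hΓ hle ξ B _ => ?_⟩
  have hsq := sq_le_of_le_rpow_mul_logb hp.out.two_le hle
  exact ⟨not_isNontrivialRep A Γ hA hΓ hsq ξ B _ subset_rfl Set.subset_union_left,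
    not_isNontrivialRep A Γ hA hΓ hsq ξ B _ Set.subset_union_left subset_rfl⟩
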